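/- **Setting.** Let $\mathcal G=(\mathbb V,\mathbb E)$ be a finite digraph with $\mathbb E\subset\mathbb V\times\mathbb V$ that is balanced (at every node the in-degree equals the out-degree) and has a globally reachable node (a node that can be reached from every other node along a directed walk). Let $\max(D_o)$ be its maximal out-degree. Define $B_o,B_i\in\mathbb R^{|\mathbb V|\times|\mathbb E|}$ by $[B_o]_{ik}=1$ if the edge $k$ starts at $i$ and $0$ otherwise, $[B_i]_{ik}=-1$ if the edge $k$ ends at $i$ and $0$ otherwise, and put $E=B_o+B_i$. Each node $i$ carries an agent $\Sigma_i^o:\ \dot x_i=f_i(x_i,u_i),\ y_i=h_i(x_i)$ with state $x_i\in\mathbb R^{n_i}$, scalar input and output, and continuously differentiable $f_i,h_i$. Each edge $k$ carries a controller $\Pi_k:\ \dot\eta_k=\phi_k(\eta_k,\zeta_k),\ \mu_k=\psi_k(\eta_k,\zeta_k)$ with state $\eta_k\in\mathbb R^{m_k}$ ($m_k=0$ allowed, i.e. a memoryless controller), scalar input and output, and continuous $\psi_k$. The decomposed network $(\Sigma^o,\Pi,\mathcal G,w)$ is the interconnection $\zeta=E^\top y$, $z=E\mu$, $w=B_i\mu$,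 $u=w-z$ (so $u=-B_o\mu$). A system $\dot x=f(x,u)$, $y=h(x,u)$ with scalar input and output is called OP-$\varepsilon$ if $\varepsilon>0$ and there are $\delta\ge0$ and a storage function $Q$ (continuously differentiable, $Q(0)=0$, $Q\ge0$, and radially unbounded, i.e. $Q(x)\to\infty$ as $\|x\|\to\infty$) such that, with $y=h(x,u)$, $\nabla Q(x)^\top f(x,u)\le uy-\varepsilon y^2-\delta u^2$ for all $x,u$. A state $x_0$ of $\Sigma_i^o$ is asymptotically reachable from $\{0\}$ if there are an input on $(-\infty,0]$ and a corresponding trajectory of the state equation with $x_i(0)=x_0$ and $x_i(t)\to0$ as $t\to-\infty$. **Theorem.** Assume that every agent $\Sigma_i^o$ is OP-$\varepsilon_i$, that every controller $\Pi_k$ is OP-$\alpha_k$, and that $$\min_k\alpha_k\ \ge\ \frac{\max(D_o)}{\min_i\varepsilon_i}$$ (a condition that is void if there are no edges). Then for every trajectory of the decomposed network $(\Sigma^o,\Pi,\mathcal G,w)$ on $[0,\infty)$ whose initial agent states $x_i(0)$ are asymptotically reachable from $\{0\}$, $$\lim_{t\to\infty}\mathrm{proj}_{S^\perp}(y(t))=0\qquad\text{and}\qquad\lim_{t\to\infty}y(t)=0,$$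 where $\mathrm{proj}_{S^\perp}(y)=\left(I-\tfrac1{|\mathbb V|}\mathbb 1\mathbb 1^\top\right)y$ is the orthogonal projection onto the orthogonal complement of $S=\mathrm{span}(\mathbb 1)$. -/

import Mathlib

open Filter Topology
open scoped Matrix

namespace PassiveNetwork

/-! ### Digraphs -/

section Graph

variable {V : Type*} [Fintype V] [DecidableEq V] (G : Digraph V) [DecidableRel G.Adj]

/-- The edges of a digraph: ordered pairs `(i, j)` with an arrow from `i` to `j`. -/
abbrev Edge (G : Digraph V) : Type _ := {e : V × V // G.Adj e.1 e.2}

/-- Number of edges that leave `i`. -/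
def outDegree (i : V) : ℕ := (Finset.univ.filter fun j => G.Adj i j).card

/-- Number of edges that enter `i`. -/
def inDegree (i : V) : ℕ := (Finset.univ.filter fun j => G.Adj j i).card

/-- The maximal out-degree `max(D_o)`. -/
def maxOutDegree : ℕ := Finset.univ.sup (outDegree G)

/-- A digraph is balanced if the in-degree equals the out-degree at every node. -/
def IsBalanced : Prop := ∀ i, inDegree G i = outDegree G i

/-- Some node can be reached from every node along a directed walk. -/
def HasGloballyReachableNode : Prop := ∃ r, ∀ v, Relation.ReflTransGen G.Adj v r

/-- Out-incidence matrix: `1` at `(i, k)` if the edge `k` starts at `i`. -/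
def outIncidence : Matrix V (Edge G) ℝ := fun i k => if k.1.1 = i then 1 else 0

/-- In-incidence matrix: `-1` at `(i, k)` if the edge `k` ends at `i`. -/
def inIncidence : Matrix V (Edge G) ℝ := fun i k => if k.1.2 = i then -1 else 0

/-- Incidence matrix `E = B_o + B_i`. -/
def incidence : Matrix V (Edge G) ℝ := outIncidence G + inIncidence G

end Graph

/-- Orthogonal projection onto the disagreement space `span(𝟙)ᗮ`:
`y ↦ (I - (1/n) 𝟙 𝟙ᵀ) y`. -/
noncomputable def disagreementProj {V : Type*} [Fintype V] [DecidableEq V] (y : V → ℝ) : V → ℝ :=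
  (1 - (1 / (Fintype.card V : ℝ)) •
    Matrix.vecMulVec (fun _ : V => (1 : ℝ)) (fun _ : V => (1 : ℝ))) *ᵥ y

/-! ### Single-input single-output systems and passivity -/

/-- The state space `ℝⁿ` with the Euclidean norm (`n = 0` gives memoryless systems). -/
abbrev StateSpace (n : ℕ) : Type := EuclideanSpace ℝ (Fin n)

/-- A system `ẋ = f(x, u)`, `y = h(x, u)` with scalar input and output. -/
structure SISOSystem (n : ℕ) where
  /-- right-hand side of the state equation -/
  f : StateSpace n → ℝ → StateSpace n
  /-- output map -/
  h : StateSpace n → ℝ → ℝ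

/-- A system `ẋ = f(x, u)`, `y = h(x)`, whose output depends on the state only. -/
structure Agent (n : ℕ) where
  /-- right-hand side of the state equation -/
  f : StateSpace n → ℝ → StateSpace n
  /-- output map -/
  h : StateSpace n → ℝ

/-- An agent regarded as a system. -/
def Agent.toSISOSystem {n : ℕ} (A : Agent n) : SISOSystem n := ⟨A.f, fun x _ => A.h x⟩

/-- `f` and `h` are continuously differentiable. -/
def Agent.IsC1 {n : ℕ} (A : Agent n) : Prop :=
  ContDiff ℝ 1 (fun p : StateSpace n × ℝ => A.f p.1 p.2) ∧ ContDiff ℝ 1 A.h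

/-- Continuously differentiable, positive semidefinite and radially unbounded functions of the
state. -/
structure IsStorageFunction {n : ℕ} (Q : StateSpace n → ℝ) : Prop where
  contDiff : ContDiff ℝ 1 Q
  map_zero : Q 0 = 0
  nonneg : ∀ x, 0 ≤ Q x
  radially_unbounded : Tendsto Q (Bornology.cobounded (StateSpace n)) atTop

/-- The dissipation inequality `Q̇ ≤ u y - ε y² - δ u²`, for all states and inputs, where
`Q̇ = ⟨∇Q(x), f(x, u)⟩` is the derivative of `Q` along the system. -/
def SISOSystem.Dissipates {n : ℕ} (P : SISOSystem n) (Q : StateSpace n → ℝ) (ε δ : ℝ) : Prop :=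
  ∀ x u, fderiv ℝ Q x (P.f x u) ≤ u * P.h x u - ε * P.h x u ^ 2 - δ * u ^ 2

/-- The system is output strictly passive with constant `ε` (OP-`ε`). -/
def SISOSystem.IsOutputStrictlyPassive {n : ℕ} (P : SISOSystem n) (ε : ℝ) : Prop :=
  0 < ε ∧ ∃ δ : ℝ, 0 ≤ δ ∧ ∃ Q, IsStorageFunction Q ∧ P.Dissipates Q ε δ

/-- `x₀` is asymptotically reachable from `{0}`: some input on `(-∞, 0]` has a corresponding
trajectory (of the state equation in integrated form, so that the input need not be continuous)
with `x(0) = x₀` and `x(t) → 0` as `t → -∞`. -/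
def Agent.AsymptoticallyReachable {n : ℕ} (A : Agent n) (x₀ : StateSpace n) : Prop :=
  ∃ (u : ℝ → ℝ) (x : ℝ → StateSpace n),
    (∀ s t : ℝ, s ≤ t → t ≤ 0 →
      IntervalIntegrable (fun r => A.f (x r) (u r)) MeasureTheory.volume s t ∧
        x t - x s = ∫ r in s..t, A.f (x r) (u r)) ∧
    x 0 = x₀ ∧ Tendsto x atBot (𝓝 0)

/-! ### The decomposed network -/

/-- Signals `x, u, y, η, ζ, μ, z, w` on `[0, ∞)` of the decomposed network: the agents
`ẋᵢ = fᵢ(xᵢ, uᵢ)`, `yᵢ = hᵢ(xᵢ)`, the edge controllers `η̇ₖ = φₖ(ηₖ, ζₖ)`, `μₖ = ψₖ(ηₖ, ζₖ)`, and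
the interconnection `ζ = Eᵀ y`, `z = E μ`, `w = B_i μ`, `u = w - z`. -/
structure IsTrajectory {V : Type*} [Fintype V] [DecidableEq V]
    (G : Digraph V) [DecidableRel G.Adj]
    {n : V → ℕ} (agent : ∀ i, Agent (n i))
    {m : Edge G → ℕ} (ctrl : ∀ k, SISOSystem (m k))
    (x : ∀ i, ℝ → StateSpace (n i)) (u y : ℝ → V → ℝ)
    (η : ∀ k, ℝ → StateSpace (m k)) (ζ μ : ℝ → Edge G → ℝ) (z w : ℝ → V → ℝ) : Prop where
  agent_state : ∀ t, 0 ≤ t → ∀ i,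
    HasDerivWithinAt (x i) ((agent i).f (x i t) (u t i)) (Set.Ici 0) t
  agent_output : ∀ t, 0 ≤ t → ∀ i, y t i = (agent i).h (x i t)
  ctrl_state : ∀ t, 0 ≤ t → ∀ k,
    HasDerivWithinAt (η k) ((ctrl k).f (η k t) (ζ t k)) (Set.Ici 0) t
  ctrl_output : ∀ t, 0 ≤ t → ∀ k, μ t k = (ctrl k).h (η k t) (ζ t k)
  ctrl_input : ∀ t, 0 ≤ t → ζ t = (incidence G)ᵀ *ᵥ y t
  feedback : ∀ t, 0 ≤ t → z t = incidence G *ᵥ μ t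
  external : ∀ t, 0 ≤ t → w t = inIncidence G *ᵥ μ t
  agent_input : ∀ t, 0 ≤ t → u t = w t - z t

end PassiveNetwork

namespace PassiveNetwork

open Set Bornology

/-! ### Convergence of signals dominated by the decay of a storage function -/

/-! The sum `U` of all storage functions is a Lyapunov function. Since `Eᵀ` and `E` are adjoint, the
exchange between agents and controllers cancels, leaving the supply `w ⬝ᵥ y`, i.e. minus the sum
over edges of `y` at the head times `μ` (`interconnection_power`). Young's inequality splits each
product. Balance bounds the number of edges entering a node by the maximal out-degree, so the gain
condition lets half of each output penalty absorb this supply (`IsBalanced.cross_term_le`), and `U'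
≤ -c ∑ yᵢ²` (`IsTrajectory.exists_storage`). Hence `U` is bounded by `U 0`, and radial unboundedness
bounds all states. The signals and the derivatives of the outputs are then bounded too, and a
Barbalat argument (`tendsto_zero_of_sq_le_decay`) gives `y → 0`. The projection follows by
continuity. -/

theorem sub_le_mul_sub_of_hasDerivWithinAt_Ici {g g' : ℝ → ℝ} {C s t : ℝ} (hs : 0 ≤ s)
    (hst : s ≤ t) (hg : ∀ r, 0 ≤ r → HasDerivWithinAt g (g' r) (Ici 0) r)
    (hC : ∀ r ∈ Icc s t, g' r ≤ C) : g t - g s ≤ C * (t - s) := by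
  -- At `0` the derivative is only one-sided, but the mean value inequality needs derivatives only
  -- in the interior.
  have hd : ∀ r ∈ interior (Icc s t), HasDerivAt g (g' r) r := by
    intro r hr
    rw [interior_Icc] at hr
    have h0 : 0 < r := hs.trans_lt hr.1
    exact (hg r h0.le).hasDerivAt (Ici_mem_nhds h0)
  refine (convex_Icc s t).image_sub_le_mul_sub_of_deriv_le ?_ ?_ ?_ s (left_mem_Icc.2 hst) t
    (right_mem_Icc.2 hst) hst
  · intro r hr
    exact ((hg r (hs.trans hr.1)).continuousWithinAt).mono fun a ha => hs.trans ha.1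
  · exact fun r hr => (hd r hr).differentiableAt.differentiableWithinAt
  · exact fun r hr => (hd r hr).deriv ▸ hC r (interior_subset hr)

theorem abs_sub_le_mul_sub_of_hasDerivWithinAt_Ici {g g' : ℝ → ℝ} {L s t : ℝ} (hs : 0 ≤ s)
    (hst : s ≤ t) (hg : ∀ r, 0 ≤ r → HasDerivWithinAt g (g' r) (Ici 0) r)
    (hL : ∀ r, 0 ≤ r → |g' r| ≤ L) : |g t - g s| ≤ L * (t - s) := by
  refine abs_le'.2 ⟨?_, ?_⟩
  · exact sub_le_mul_sub_of_hasDerivWithinAt_Ici hs hst hg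
      fun r hr => (abs_le.1 (hL r (hs.trans hr.1))).2
  · have := sub_le_mul_sub_of_hasDerivWithinAt_Ici (g := fun r => -g r) hs hst
      (fun r hr => (hg r hr).neg) (C := L)
      fun r hr => by linarith [(abs_le.1 (hL r (hs.trans hr.1))).1]
    linarith

/-- A form of Barbalat's lemma: a signal with bounded derivative whose square bounds the decay
rate of a nonnegative function tends to zero. -/
theorem tendsto_zero_of_sq_le_decay {U U' y y' : ℝ → ℝ} {c L : ℝ} (hc : 0 < c)
    (hU : ∀ t, 0 ≤ t → HasDerivWithinAt U (U' t) (Ici 0) t)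
    (hdecay : ∀ t, 0 ≤ t → U' t ≤ -c * y t ^ 2) (hnn : ∀ t, 0 ≤ t → 0 ≤ U t)
    (hy : ∀ t, 0 ≤ t → HasDerivWithinAt y (y' t) (Ici 0) t)
    (hL : ∀ t, 0 ≤ t → |y' t| ≤ L) : Tendsto y atTop (𝓝 0) := by
  have hL0 : 0 ≤ L := (abs_nonneg _).trans (hL 0 le_rfl)
  have hanti : ∀ s t, 0 ≤ s → s ≤ t → U t ≤ U s := by
    intro s t hs hst
    have := sub_le_mul_sub_of_hasDerivWithinAt_Ici hs hst hU (C := 0) fun r hr =>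
      (hdecay r (hs.trans hr.1)).trans (by nlinarith [sq_nonneg (y r)])
    linarith
  -- Nothing is known of `U` at negative times; composing with `max t 0` makes it antitone and
  -- bounded below on all of `ℝ`.
  obtain ⟨l, hl⟩ : ∃ l, Tendsto (fun t => U (max t 0)) atTop (𝓝 l) :=
    ⟨_, tendsto_atTop_ciInf
      (fun a b hab => hanti _ _ (le_max_right _ _) (max_le_max_right _ hab))
      ⟨0, by rintro _ ⟨t, rfl⟩; exact hnn _ (le_max_right _ _)⟩⟩
  rw [Metric.tendsto_atTop]
  intro e he
  -- On a window of length `τ` the signal `y` moves by at most `e / 2`; the `+ 1` covers `L = 0`.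
  set τ : ℝ := e / (2 * (L + 1)) with hτ
  have hτ0 : 0 < τ := by positivity
  have hLτ : L * τ ≤ e / 2 := by
    rw [hτ, mul_div_assoc', div_le_div_iff₀ (by positivity) two_pos]
    nlinarith
  have hdiff : Tendsto (fun t => U (max t 0) - U (max (t + τ) 0)) atTop (𝓝 0) := by
    simpa using hl.sub (hl.comp (tendsto_atTop_add_const_right _ τ tendsto_id))
  have hpos : 0 < c * (e / 2) ^ 2 * τ := by positivity
  obtain ⟨T, hT⟩ := eventually_atTop.1 (hdiff.eventually (gt_mem_nhds hpos))
  refine ⟨max T 0, fun t ht => ?_⟩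
  have ht0 : 0 ≤ t := (le_max_right _ _).trans ht
  have hlt := hT t ((le_max_left _ _).trans ht)
  rw [max_eq_left ht0, max_eq_left (by positivity)] at hlt
  rw [Real.dist_eq, sub_zero]
  -- If `|y t| ≥ e`, then `|y| ≥ e / 2` on the whole window, so `U` drops there by at least `c * (e
  -- / 2) ^ 2 * τ`, which convergence of `U` forbids at late times.
  by_contra! hge
  have := sub_le_mul_sub_of_hasDerivWithinAt_Ici ht0 (by linarith : t ≤ t + τ) hU
    (C := -(c * (e / 2) ^ 2)) fun r hr => by
      have h1 := abs_sub_le_mul_sub_of_hasDerivWithinAt_Ici ht0 hr.1 hy hL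
      have h2 : L * (r - t) ≤ L * τ := mul_le_mul_of_nonneg_left (by linarith [hr.2]) hL0
      have h3 : |y t| ≤ |y r| + |y r - y t| := by
        have := abs_sub_abs_le_abs_sub (y t) (y r)
        rw [abs_sub_comm] at this
        linarith
      have h4 : (e / 2) ^ 2 ≤ y r ^ 2 := by
        rw [← sq_abs (y r)]
        exact pow_le_pow_left₀ (by positivity) (by linarith) 2
      have := hdecay r (ht0.trans hr.1)
      nlinarith
  rw [add_sub_cancel_left] at this
  linarith

/-! ### Bounded signals -/

section Bounded

variable {X Y T : Type*}

theorem isBounded_image_comp [PseudoMetricSpace X] [ProperSpace X] [PseudoMetricSpace Y]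
    {g : X → Y} (hg : Continuous g) {p : T → X} {s : Set T} (hp : IsBounded (p '' s)) :
    IsBounded ((fun t => g (p t)) '' s) := by
  refine (hp.isCompact_closure.image hg).isBounded.subset ?_
  rintro _ ⟨t, ht, rfl⟩
  exact ⟨p t, subset_closure ⟨t, ht, rfl⟩, rfl⟩

theorem isBounded_image_prodMk [PseudoMetricSpace X] [PseudoMetricSpace Y]
    {p : T → X} {q : T → Y} {s : Set T} (hp : IsBounded (p '' s)) (hq : IsBounded (q '' s)) :
    IsBounded ((fun t => (p t, q t)) '' s) := by
  refine (hp.prod hq).subset ?_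
  rintro _ ⟨t, ht, rfl⟩
  exact ⟨⟨t, ht, rfl⟩, ⟨t, ht, rfl⟩⟩

theorem isBounded_image_pi {ι : Type*} [Fintype ι] {p : T → ι → ℝ} {s : Set T}
    (hp : ∀ i, IsBounded ((fun t => p t i) '' s)) : IsBounded (p '' s) := by
  rw [← forall_isBounded_image_eval_iff]
  intro i
  rw [image_image]
  exact hp i

end Bounded

/-- Sublevel sets of a radially unbounded function are bounded. -/
theorem IsStorageFunction.isBounded_image {n : ℕ} {Q : StateSpace n → ℝ}
    (hQ : IsStorageFunction Q) {T : Type*} {p : T → StateSpace n} {s : Set T} {C : ℝ}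
    (hC : ∀ t ∈ s, Q (p t) ≤ C) : IsBounded (p '' s) := by
  have h := hQ.radially_unbounded.eventually (eventually_gt_atTop C)
  refine (show IsBounded {x | Q x ≤ C} from isBounded_def.2 ?_).subset ?_
  · filter_upwards [h] with x hx using not_le.2 hx
  · rintro _ ⟨t, ht, rfl⟩
    exact hC t ht

theorem IsStorageFunction.hasDerivWithinAt_comp {n : ℕ} {Q : StateSpace n → ℝ}
    (hQ : IsStorageFunction Q) {p : ℝ → StateSpace n} {v : StateSpace n} {s : Set ℝ} {t : ℝ}
    (hp : HasDerivWithinAt p v s t) :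
    HasDerivWithinAt (fun r => Q (p r)) (fderiv ℝ Q (p t) v) s t :=
  ((hQ.contDiff.differentiable one_ne_zero (p t)).hasFDerivAt).comp_hasDerivWithinAt t hp

/-! ### Power balance of the interconnection -/

section Balance

variable {V : Type*} [Fintype V] (G : Digraph V) [DecidableRel G.Adj]

theorem sum_edge_head (a : V → ℝ) :
    ∑ k : Edge G, a k.1.2 = ∑ i, (inDegree G i : ℝ) * a i := by
  have h (i : V) : (inDegree G i : ℝ) * a i = ∑ j, if G.Adj j i then a i else 0 := by
    rw [← Finset.sum_filter, Finset.sum_const, nsmul_eq_mul, inDegree]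
  rw [Finset.sum_congr rfl fun i _ => h i, Finset.sum_comm,
    ← Fintype.sum_prod_type' (f := fun j i => if G.Adj j i then a i else 0), ← Finset.sum_filter]
  exact (Finset.sum_subtype _ (by simp) fun e : V × V => a e.2).symm

theorem dotProduct_inIncidence_mulVec [DecidableEq V] (y : V → ℝ) (μ : Edge G → ℝ) :
    y ⬝ᵥ inIncidence G *ᵥ μ = -∑ k, y k.1.2 * μ k := by
  simp only [dotProduct, Matrix.mulVec, inIncidence, Finset.mul_sum]
  rw [Finset.sum_comm, ← Finset.sum_neg_distrib]
  refine Finset.sum_congr rfl fun k _ => ?_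
  simp [ite_mul, mul_ite]

/-- The supply of power by the interconnection `ζ = Eᵀ y`, `u = B_i μ - E μ`. -/
theorem interconnection_power [DecidableEq V] (y : V → ℝ) (μ : Edge G → ℝ) :
    (inIncidence G *ᵥ μ - incidence G *ᵥ μ) ⬝ᵥ y + ((incidence G)ᵀ *ᵥ y) ⬝ᵥ μ
      = -∑ k, y k.1.2 * μ k := by
  -- Moving `Eᵀ` across the product turns the second term into `y ⬝ᵥ E μ`, which cancels against the
  -- feedback `z`.
  rw [← dotProduct_inIncidence_mulVec, Matrix.mulVec_transpose, ← Matrix.dotProduct_mulVec,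
    sub_dotProduct, dotProduct_comm (incidence G *ᵥ μ), dotProduct_comm _ y]
  ring

variable {G}

theorem IsBalanced.inDegree_le_maxOutDegree (hbal : IsBalanced G) (i : V) :
    inDegree G i ≤ maxOutDegree G :=
  hbal i ▸ Finset.le_sup (f := outDegree G) (Finset.mem_univ i)

/-- Under the gain condition, the cross terms are dominated by the output penalties. -/
theorem IsBalanced.cross_term_le (hbal : IsBalanced G) {e a : ℝ} (he : 0 < e)
    (hgain : (maxOutDegree G : ℝ) / e ≤ a) (y : V → ℝ) (μ : Edge G → ℝ)
    (ha : ∀ _ : Edge G, 0 < a) :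
    -∑ k, y k.1.2 * μ k ≤ e / 2 * ∑ i, y i ^ 2 + a / 2 * ∑ k, μ k ^ 2 := by
  -- Without edges `a` need not be positive, but then both sums over edges vanish.
  rcases isEmpty_or_nonempty (Edge G) with h | ⟨⟨k₀⟩⟩
  · simp only [Finset.univ_eq_empty, Finset.sum_empty]
    have : 0 ≤ ∑ i, y i ^ 2 := Finset.sum_nonneg fun i _ => sq_nonneg _
    simp only [neg_zero, mul_zero, add_zero]
    positivity
  have ha := ha k₀
  -- Young's inequality with weight `a`, by completing the square.
  have h1 : -∑ k, y k.1.2 * μ k ≤ ∑ k : Edge G, (y k.1.2 ^ 2 / (2 * a) + a / 2 * μ k ^ 2) := by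
    rw [← Finset.sum_neg_distrib]
    refine Finset.sum_le_sum fun k _ => ?_
    have : y k.1.2 ^ 2 / (2 * a) + a / 2 * μ k ^ 2 + y k.1.2 * μ k
        = (y k.1.2 + a * μ k) ^ 2 / (2 * a) := by
      field_simp
      ring
    have h2 : 0 ≤ (y k.1.2 + a * μ k) ^ 2 / (2 * a) := by positivity
    linarith
  rw [Finset.sum_add_distrib, sum_edge_head G (fun i => y i ^ 2 / (2 * a)),
    ← Finset.mul_sum] at h1
  refine h1.trans (add_le_add_left ?_ _)
  rw [Finset.mul_sum]
  refine Finset.sum_le_sum fun i _ => ?_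
  have h2 : (inDegree G i : ℝ) ≤ a * e :=
    (Nat.cast_le.2 (hbal.inDegree_le_maxOutDegree i)).trans ((div_le_iff₀ he).1 hgain)
  calc (inDegree G i : ℝ) * (y i ^ 2 / (2 * a)) ≤ a * e * (y i ^ 2 / (2 * a)) :=
        mul_le_mul_of_nonneg_right h2 (by positivity)
    _ = e / 2 * y i ^ 2 := by field_simp

end Balance

/-! ### Convergence of the outputs -/

/-- Adds all dissipation inequalities, weakened to the smallest `ε i` and `α k`, and drops the
nonpositive input terms. Half of the smallest `ε i` pays for the cross terms; the other half is the
decay rate `c`. -/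
theorem IsTrajectory.exists_storage {V : Type*} [Fintype V] [DecidableEq V]
    {G : Digraph V} [DecidableRel G.Adj] (hbal : IsBalanced G) [Nonempty V]
    {n : V → ℕ} {agent : ∀ i, Agent (n i)}
    {m : Edge G → ℕ} {ctrl : ∀ k, SISOSystem (m k)}
    {ε : V → ℝ} (hε0 : ∀ i, 0 < ε i) {δ : V → ℝ} (hδ : ∀ i, 0 ≤ δ i)
    {Q : ∀ i, StateSpace (n i) → ℝ} (hQ : ∀ i, IsStorageFunction (Q i))
    (hdis : ∀ i, (agent i).toSISOSystem.Dissipates (Q i) (ε i) (δ i))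
    {α : Edge G → ℝ} (hα0 : ∀ k, 0 < α k) {γ : Edge G → ℝ} (hγ : ∀ k, 0 ≤ γ k)
    {W : ∀ k, StateSpace (m k) → ℝ} (hW : ∀ k, IsStorageFunction (W k))
    (hdisW : ∀ k, (ctrl k).Dissipates (W k) (α k) (γ k))
    (hgain : (maxOutDegree G : ℝ) / (⨅ i, ε i) ≤ ⨅ k, α k)
    {x : ∀ i, ℝ → StateSpace (n i)} {u y : ℝ → V → ℝ}
    {η : ∀ k, ℝ → StateSpace (m k)} {ζ μ : ℝ → Edge G → ℝ} {z w : ℝ → V → ℝ}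
    (htraj : IsTrajectory G agent ctrl x u y η ζ μ z w) :
    ∃ c : ℝ, 0 < c ∧ ∃ U' : ℝ → ℝ, ∀ t, 0 ≤ t →
      HasDerivWithinAt (fun t => ∑ i, Q i (x i t) + ∑ k, W k (η k t)) (U' t) (Ici 0) t ∧
      U' t ≤ -c * ∑ i, y t i ^ 2 := by
  obtain ⟨i₀, hi₀⟩ := exists_eq_ciInf_of_finite (f := ε)
  have he : 0 < ⨅ i, ε i := hi₀ ▸ hε0 i₀
  have hle : ∀ i, ⨅ i, ε i ≤ ε i := ciInf_le (Set.finite_range ε).bddBelow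
  have hleα : ∀ k, ⨅ k, α k ≤ α k := ciInf_le (Set.finite_range α).bddBelow
  -- With no edges the real infimum takes the default value `0`, so positivity is claimed only given
  -- an edge.
  have ha : ∀ _ : Edge G, 0 < ⨅ k, α k := by
    intro k
    have : Nonempty (Edge G) := ⟨k⟩
    obtain ⟨k₀, hk₀⟩ := exists_eq_ciInf_of_finite (f := α)
    exact hk₀ ▸ hα0 k₀
  refine ⟨(⨅ i, ε i) / 2, by positivity, fun t =>
    ∑ i, fderiv ℝ (Q i) (x i t) ((agent i).f (x i t) (u t i)) +
      ∑ k, fderiv ℝ (W k) (η k t) ((ctrl k).f (η k t) (ζ t k)), fun t ht => ⟨?_, ?_⟩⟩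
  · exact (HasDerivWithinAt.fun_sum fun i _ =>
      (hQ i).hasDerivWithinAt_comp (htraj.agent_state t ht i)).add
      (HasDerivWithinAt.fun_sum fun k _ =>
      (hW k).hasDerivWithinAt_comp (htraj.ctrl_state t ht k))
  have h1 : ∑ i, fderiv ℝ (Q i) (x i t) ((agent i).f (x i t) (u t i))
      ≤ u t ⬝ᵥ y t - (⨅ i, ε i) * ∑ i, y t i ^ 2 := by
    rw [dotProduct, Finset.mul_sum, ← Finset.sum_sub_distrib]
    refine Finset.sum_le_sum fun i _ => ?_
    have h := hdis i (x i t) (u t i)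
    simp only [Agent.toSISOSystem, ← htraj.agent_output t ht i] at h
    have h2 := mul_nonneg (hδ i) (sq_nonneg (u t i))
    have h3 := mul_le_mul_of_nonneg_right (hle i) (sq_nonneg (y t i))
    linarith
  have h2 : ∑ k, fderiv ℝ (W k) (η k t) ((ctrl k).f (η k t) (ζ t k))
      ≤ ζ t ⬝ᵥ μ t - (⨅ k, α k) * ∑ k, μ t k ^ 2 := by
    rw [dotProduct, Finset.mul_sum, ← Finset.sum_sub_distrib]
    refine Finset.sum_le_sum fun k _ => ?_
    have h := hdisW k (η k t) (ζ t k)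
    rw [← htraj.ctrl_output t ht k] at h
    have h2 := mul_nonneg (hγ k) (sq_nonneg (ζ t k))
    have h3 := mul_le_mul_of_nonneg_right (hleα k) (sq_nonneg (μ t k))
    linarith
  have h3 := interconnection_power G (y t) (μ t)
  rw [← htraj.ctrl_input t ht, ← htraj.feedback t ht, ← htraj.external t ht,
    ← htraj.agent_input t ht] at h3
  have h4 := hbal.cross_term_le he hgain (y t) (μ t) ha
  have h5 : 0 ≤ (⨅ k, α k) * ∑ k, μ t k ^ 2 := by
    rw [Finset.mul_sum]
    exact Finset.sum_nonneg fun k _ => mul_nonneg (ha k).le (sq_nonneg _)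
  linarith

/-- If the states of the network are bounded, so are the derivatives of the agent
outputs. -/
theorem IsTrajectory.exists_deriv_output {V : Type*} [Fintype V] [DecidableEq V]
    {G : Digraph V} [DecidableRel G.Adj]
    {n : V → ℕ} {agent : ∀ i, Agent (n i)} (hagent : ∀ i, (agent i).IsC1)
    {m : Edge G → ℕ} {ctrl : ∀ k, SISOSystem (m k)}
    (hctrl : ∀ k, Continuous fun p : StateSpace (m k) × ℝ => (ctrl k).h p.1 p.2)
    {x : ∀ i, ℝ → StateSpace (n i)} {u y : ℝ → V → ℝ}
    {η : ∀ k, ℝ → StateSpace (m k)} {ζ μ : ℝ → Edge G → ℝ} {z w : ℝ → V → ℝ}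
    (htraj : IsTrajectory G agent ctrl x u y η ζ μ z w)
    (hx : ∀ i, IsBounded (x i '' Ici 0)) (hη : ∀ k, IsBounded (η k '' Ici 0)) (i : V) :
    ∃ (y' : ℝ → ℝ) (L : ℝ), ∀ t, 0 ≤ t →
      HasDerivWithinAt (fun t => y t i) (y' t) (Ici 0) t ∧ |y' t| ≤ L := by
  -- Agent outputs depend on the state alone, so bounds pass from the states to `y`, `ζ`, `μ` and
  -- `u` in turn, without an algebraic loop.
  have hy : IsBounded (y '' Ici 0) := isBounded_image_pi fun j => by
    rw [image_congr fun t (ht : t ∈ Ici 0) => htraj.agent_output t ht j]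
    exact isBounded_image_comp (hagent j).2.continuous (hx j)
  have hζ : IsBounded (ζ '' Ici 0) := by
    rw [image_congr fun t (ht : t ∈ Ici 0) => htraj.ctrl_input t ht]
    exact isBounded_image_comp (g := fun y => (incidence G)ᵀ *ᵥ y) (by fun_prop) hy
  have hμ : IsBounded (μ '' Ici 0) := isBounded_image_pi fun k => by
    rw [image_congr fun t (ht : t ∈ Ici 0) => htraj.ctrl_output t ht k]
    exact isBounded_image_comp (hctrl k)
      (isBounded_image_prodMk (hη k) (isBounded_image_comp (continuous_apply k) hζ))
  have hu : IsBounded (u '' Ici 0) := by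
    have h : ∀ t ∈ Ici (0 : ℝ), u t = inIncidence G *ᵥ μ t - incidence G *ᵥ μ t := fun t ht => by
      rw [htraj.agent_input t ht, htraj.external t ht, htraj.feedback t ht]
    rw [image_congr h]
    exact isBounded_image_comp (g := fun μ => inIncidence G *ᵥ μ - incidence G *ᵥ μ)
      (by fun_prop) hμ
  have hcont : Continuous fun p : StateSpace (n i) × ℝ =>
      fderiv ℝ (agent i).h p.1 ((agent i).f p.1 p.2) :=
    (((hagent i).2.continuous_fderiv one_ne_zero).comp continuous_fst).clm_apply
      (hagent i).1.continuous
  obtain ⟨L, hL⟩ := (isBounded_image_comp hcont (isBounded_image_prodMk (hx i)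
    (isBounded_image_comp (continuous_apply i) hu))).exists_norm_le
  refine ⟨fun t => fderiv ℝ (agent i).h (x i t) ((agent i).f (x i t) (u t i)), L,
    fun t ht => ⟨?_, hL _ ⟨t, ht, rfl⟩⟩⟩
  exact (((hagent i).2.differentiable one_ne_zero (x i t)).hasFDerivAt.comp_hasDerivWithinAt t
    (htraj.agent_state t ht i)).congr_of_mem (fun s hs => htraj.agent_output s hs i) ht

end PassiveNetwork

/-! ### Lyapunov argument for the whole network -/

theorem mainTheorem1 {V : Type*} [Fintype V] [DecidableEq V]
    (G : Digraph V) [DecidableRel G.Adj]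
    (hbal : PassiveNetwork.IsBalanced G) (hreach : PassiveNetwork.HasGloballyReachableNode G)
    {n : V → ℕ} (agent : ∀ i, PassiveNetwork.Agent (n i))
    (hagent : ∀ i, (agent i).IsC1)
    {m : PassiveNetwork.Edge G → ℕ} (ctrl : ∀ k, PassiveNetwork.SISOSystem (m k))
    (hctrl : ∀ k, Continuous fun p : PassiveNetwork.StateSpace (m k) × ℝ => (ctrl k).h p.1 p.2)
    (ε : V → ℝ) (hε : ∀ i, (agent i).toSISOSystem.IsOutputStrictlyPassive (ε i))
    (α : PassiveNetwork.Edge G → ℝ) (hα : ∀ k, (ctrl k).IsOutputStrictlyPassive (α k))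
    (hgain : (PassiveNetwork.maxOutDegree G : ℝ) / (⨅ i, ε i) ≤ ⨅ k, α k)
    (x : ∀ i, ℝ → PassiveNetwork.StateSpace (n i)) (u y : ℝ → V → ℝ)
    (η : ∀ k, ℝ → PassiveNetwork.StateSpace (m k)) (ζ μ : ℝ → PassiveNetwork.Edge G → ℝ)
    (z w : ℝ → V → ℝ)
    (htraj : PassiveNetwork.IsTrajectory G agent ctrl x u y η ζ μ z w)
    (hx₀ : ∀ i, (agent i).AsymptoticallyReachable (x i 0)) :
    Tendsto (fun t => PassiveNetwork.disagreementProj (y t)) atTop (𝓝 0) ∧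
      Tendsto y atTop (𝓝 0) := by
  -- Nonemptiness makes the infimum of `ε` an attained, positive minimum.
  have hVne : Nonempty V := ⟨hreach.choose⟩
  choose hε0 δ hδ Q hQ hdis using hε
  choose hα0 γ hγ W hW hdisW using hα
  obtain ⟨c, hc, U', hU⟩ := htraj.exists_storage hbal hε0 hδ hQ hdis hα0 hγ hW hdisW hgain
  set U : ℝ → ℝ := fun t => ∑ i, Q i (x i t) + ∑ k, W k (η k t) with hUdef
  have hQnn : ∀ t, 0 ≤ ∑ i, Q i (x i t) := fun t => Finset.sum_nonneg fun i _ => (hQ i).nonneg _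
  have hWnn : ∀ t, 0 ≤ ∑ k, W k (η k t) := fun t => Finset.sum_nonneg fun k _ => (hW k).nonneg _
  have hUle : ∀ t, 0 ≤ t → U t ≤ U 0 := by
    intro t ht
    have := PassiveNetwork.sub_le_mul_sub_of_hasDerivWithinAt_Ici le_rfl ht
      (fun r hr => (hU r hr).1) (C := 0) fun r hr => by
        have h := (hU r hr.1).2
        have : 0 ≤ c * ∑ i, y r i ^ 2 :=
          mul_nonneg hc.le (Finset.sum_nonneg fun i _ => sq_nonneg _)
        linarith
    linarith
  -- All storage terms are nonnegative, so each one alone is at most `U 0`.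
  have hx : ∀ i, Bornology.IsBounded (x i '' Set.Ici 0) := fun i =>
    (hQ i).isBounded_image (C := U 0) fun t ht => by
      have h := Finset.single_le_sum (f := fun i => Q i (x i t))
        (fun i _ => (hQ i).nonneg _) (Finset.mem_univ i)
      have := hUle t ht
      simp only [hUdef] at this h ⊢
      linarith [hWnn t]
  have hη : ∀ k, Bornology.IsBounded (η k '' Set.Ici 0) := fun k =>
    (hW k).isBounded_image (C := U 0) fun t ht => by
      have h := Finset.single_le_sum (f := fun k => W k (η k t))
        (fun k _ => (hW k).nonneg _) (Finset.mem_univ k)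
      have := hUle t ht
      simp only [hUdef] at this h ⊢
      linarith [hQnn t]
  have hy : Tendsto y atTop (𝓝 0) := by
    refine tendsto_pi_nhds.2 fun i => ?_
    obtain ⟨y', L, hy'⟩ := htraj.exists_deriv_output hagent hctrl hx hη i
    refine PassiveNetwork.tendsto_zero_of_sq_le_decay hc (fun t ht => (hU t ht).1)
      (fun t ht => (hU t ht).2.trans ?_) (fun t _ => add_nonneg (hQnn t) (hWnn t))
      (fun t ht => (hy' t ht).1) fun t ht => (hy' t ht).2
    have h := Finset.single_le_sum (f := fun i => y t i ^ 2)
      (fun i _ => sq_nonneg _) (Finset.mem_univ i)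
    exact mul_le_mul_of_nonpos_left h (neg_nonpos.2 hc.le)
  refine ⟨?_, hy⟩
  have hcont : Continuous (PassiveNetwork.disagreementProj : (V → ℝ) → V → ℝ) := by
    unfold PassiveNetwork.disagreementProj
    fun_prop
  have h0 : PassiveNetwork.disagreementProj (0 : V → ℝ) = 0 := Matrix.mulVec_zero _
  simpa only [Function.comp_def, h0] using (hcont.tendsto 0).comp hy
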